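/- Let $d\ge 1$, $q\in[1,\infty]$, $R>0$, and let $\Theta=\{x\in\mathbb R^d:\|x-c\|_q\le R/2\}$ be an $\ell_q$ ball of $\ell_q$-diameter $R$. Let $\varepsilon\ge0$, $\delta\ge 0$, $\varepsilon'>0$, $\omega\in(0,1]$. Let $\simeq$ be a symmetric neighboring relation on data sets (for instance, differing in at most one entry), and let $\mathcal M$ be a randomized mechanism with outputs in $\Theta$ that is $(\varepsilon,\delta)$-differentially private: $\mathbb P[\mathcal M(D)\in S]\le e^{\varepsilon}\,\mathbb P[\mathcal M(D')\in S]+\delta$ for all $D\simeq D'$ and all measurable $S$. Put $$\Delta=2\,d^{\,1-1/q}\,R\Big(\frac{\delta}{2\omega}\Big)^{1/d}\qquad(1/\infty:=0).$$ Given an output $x_{\mathrm{apx}}$ of $\mathcal M(D)$, set $x=x_{\mathrm{apx}}$ with probability $1-\omega$ and otherwise draw $x\sim\mathrm{Unif}(\Theta)$; then output $x_{\mathrm{pure}}=x+z$, where $z_1,\dots,z_d$ are i.i.d. Laplace of scale $2\Delta/\varepsilon'$ (with $z=0$ if $\Delta=0$), all random choices being independent of each other and of $x_{\mathrm{apx}}$.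 Then: 1. (Privacy) The mechanism $D\mapsto x_{\mathrm{pure}}$ is $(\varepsilon+\varepsilon')$-pure differentially private, that is, $(\varepsilon+\varepsilon',0)$-differentially private. 2. (Utility) For every data set $D$, if $q=1$, then $$\mathbb E\|x_{\mathrm{pure}}-x_{\mathrm{apx}}\|_1\le \omega R+\frac{4Rd}{\varepsilon'}\Big(\frac{\delta}{2\omega}\Big)^{1/d}.$$ More generally, for every $q<\infty$, $$\mathbb E\|x_{\mathrm{pure}}-x_{\mathrm{apx}}\|_q\le \omega R+\frac{4Rdq}{\varepsilon'}\Big(\frac{\delta}{2\omega}\Big)^{1/d},$$ and for every $q\in[1,\infty]$, $$\mathbb E\|x_{\mathrm{pure}}-x_{\mathrm{apx}}\|_1\le d^{\,1-1/q}\Big(\omega R+\frac{4Rd}{\varepsilon'}\Big(\frac{\delta}{2\omega}\Big)^{1/d}\Big).$$ -/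

import Mathlib

open MeasureTheory ProbabilityTheory
open scoped ENNReal

noncomputable section

namespace Purify

/-- The `ℓ_q` norm of `v ∈ ℝ^d`, `q ∈ [1, ∞]`:
`(∑ i, |v i| ^ q) ^ (1 / q)` for finite `q`, and `max_i |v i|` for `q = ∞`. -/
def lqNorm {d : ℕ} (q : ℝ≥0∞) (v : Fin d → ℝ) : ℝ :=
  ‖(WithLp.toLp q v : PiLp q fun _ : Fin d => ℝ)‖

/-- The closed `ℓ_q` ball of centre `c` and radius `ρ`; its `ℓ_q` diameter is `2 * ρ`. -/
def lqBall {d : ℕ} (q : ℝ≥0∞) (c : Fin d → ℝ) (ρ : ℝ) : Set (Fin d → ℝ) :=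
  {x | lqNorm q (x - c) ≤ ρ}

/-- The uniform distribution on a set, with respect to Lebesgue measure. -/
def unif {E : Type*} [MeasureSpace E] (S : Set E) : Measure E :=
  ProbabilityTheory.cond volume S

/-- The centred Laplace distribution of scale `b`, of density `exp (-|x| / b) / (2 * b)`.
At scale `0` it is the point mass at `0` (no noise). -/
def laplace (b : ℝ) : Measure ℝ :=
  if b = 0 then Measure.dirac 0
  else volume.withDensity fun x => ENNReal.ofReal (Real.exp (-|x| / b) / (2 * b))

/-- The law of `d` i.i.d. Laplace variables of scale `b`. -/
def laplaceVec (d : ℕ) (b : ℝ) : Measure (Fin d → ℝ) :=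
  Measure.pi fun _ => laplace b

/-- `(ε, δ)`-differential privacy of a mechanism, given by the output law `M D` on every data set
`D`, with respect to a relation `nbr` of being neighbours. Pure `ε`-DP is the case `δ = 0`. -/
def IsDP {𝒟 Y : Type*} [MeasurableSpace Y] (nbr : 𝒟 → 𝒟 → Prop) (M : 𝒟 → Measure Y)
    (ε δ : ℝ) : Prop :=
  ∀ D D', nbr D D' → ∀ S, MeasurableSet S →
    (M D).real S ≤ Real.exp ε * (M D').real S + δ

/-- The parameter `Δ = 2 d^{1 - 1/q} R (δ / (2ω))^{1/d}`. -/
def noiseDelta (d : ℕ) (q : ℝ≥0∞) (R δ ω : ℝ) : ℝ :=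
  2 * (d : ℝ) ^ (1 - (q⁻¹).toReal) * R * (δ / (2 * ω)) ^ (1 / (d : ℝ))

/-- The purified point, as a function of the input `x` and of the random draws: `t` decides whether
`x` is kept (`ω < t`) or replaced by `y`, and then the noise `z` is added. -/
def purifyPoint {d : ℕ} (ω : ℝ) (x : Fin d → ℝ) (t : ℝ) (y z : Fin d → ℝ) : Fin d → ℝ :=
  (if t ≤ ω then y else x) + z

/-- The joint law of the pair `(x_apx, x_pure)`, when `x_apx` has law `μ`: independently of
`x_apx`, draw `t ∼ Unif [0, 1]`, `y ∼ Unif Θ` and Laplace noise `z` of scale `2 Δ / ε'`. -/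
def purifyJoint {d : ℕ} (q : ℝ≥0∞) (R ε' δ ω : ℝ) (Θ : Set (Fin d → ℝ))
    (μ : Measure (Fin d → ℝ)) : Measure ((Fin d → ℝ) × (Fin d → ℝ)) :=
  (μ.prod ((unif (Set.Icc (0 : ℝ) 1)).prod
      ((unif Θ).prod (laplaceVec d (2 * noiseDelta d q R δ ω / ε'))))).map
    fun s => (s.1, purifyPoint ω s.1 s.2.1 s.2.2.1 s.2.2.2)

/-- The law of the output `x_pure`, when `x_apx` has law `μ`. -/
def purify {d : ℕ} (q : ℝ≥0∞) (R ε' δ ω : ℝ) (Θ : Set (Fin d → ℝ))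
    (μ : Measure (Fin d → ℝ)) : Measure (Fin d → ℝ) :=
  (purifyJoint q R ε' δ ω Θ μ).map Prod.snd

end Purify

end

/-! Privacy. Fix an event `S` and let `h x` be the probability that `x + z` lies in `S`. The output
probability of `S` is the integral of `h` against the mixture of the private law with the uniform
law `U`. Since log-densities of Laplace noise are Lipschitz in the `ℓ_1` norm, `h` changes by a
factor of at most `κ = exp (ε' / 2)` over `ℓ_1` distance `Δ`. By the layer-cake formula it is enough
to compare, for each `t > 0`, the mass of `{t < h}` under one mixture with that of `{t ≤ κ ^ 2 * h}`
under the other.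

If `h` crosses both thresholds inside the convex set `Θ`, it takes the value `t / κ` at some `w ∈
Θ`. Shrinking `Θ` towards `w` by the ratio `r`, with `r ^ d = δ / ω`, gives a set of `ℓ_1` radius at
most `Δ` about `w`, on which `t / κ ^ 2 ≤ h ≤ t`. It lies in the larger superlevel set and misses
the smaller one, and its weight in the mixture is `ω * r ^ d = δ`: the uniform component absorbs the
additive error. This is `mixture_superlevel_le`, integrated in `lintegral_mixture_le`; the loss `κ ^
2` is exactly `exp ε'`.

Utility. Replacing the point costs at most the diameter, with probability `ω`; the rest is a moment
of the noise. For the `ℓ_q` norm, Jensen reduces it to the `q`-th absolute moment of a Laplace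
variable, and `Γ(q + 1) ≤ q ^ q` gives the factor `q`. -/

namespace Purify

/-! ### `ℓ_q` norms and their comparison. -/

section Norm

variable {d : ℕ} {q : ℝ≥0∞}

theorem lqNorm_nonneg (hq : 1 ≤ q) (v : Fin d → ℝ) : 0 ≤ lqNorm q v :=
  have : Fact (1 ≤ q) := ⟨hq⟩
  norm_nonneg _

theorem lqNorm_zero (hq : 1 ≤ q) : lqNorm q (0 : Fin d → ℝ) = 0 := by
  have : Fact (1 ≤ q) := ⟨hq⟩
  simp [lqNorm]

theorem lqNorm_add_le (hq : 1 ≤ q) (v w : Fin d → ℝ) :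
    lqNorm q (v + w) ≤ lqNorm q v + lqNorm q w := by
  have : Fact (1 ≤ q) := ⟨hq⟩
  simpa only [lqNorm, WithLp.toLp_add] using norm_add_le (WithLp.toLp q v) (WithLp.toLp q w)

theorem lqNorm_smul (hq : 1 ≤ q) (r : ℝ) (v : Fin d → ℝ) :
    lqNorm q (r • v) = |r| * lqNorm q v := by
  have : Fact (1 ≤ q) := ⟨hq⟩
  simp only [lqNorm, WithLp.toLp_smul, norm_smul, Real.norm_eq_abs]

theorem lqNorm_sub_rev (hq : 1 ≤ q) (v w : Fin d → ℝ) :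
    lqNorm q (v - w) = lqNorm q (w - v) := by
  have h := lqNorm_smul hq (-1) (w - v)
  rw [neg_one_smul, neg_sub] at h
  simpa using h

theorem continuous_lqNorm (hq : 1 ≤ q) : Continuous (lqNorm q : (Fin d → ℝ) → ℝ) := by
  have : Fact (1 ≤ q) := ⟨hq⟩
  exact continuous_norm.comp (PiLp.continuous_toLp q _)

theorem lqNorm_one (v : Fin d → ℝ) : lqNorm 1 v = ∑ i, |v i| := by
  simp [lqNorm, PiLp.norm_eq_sum (p := 1) (by simp)]

theorem lqNorm_eq_sum (hq : 1 ≤ q) (hq' : q ≠ ∞) (v : Fin d → ℝ) :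
    lqNorm q v = (∑ i, |v i| ^ q.toReal) ^ (1 / q.toReal) := by
  have h : 0 < q.toReal := ENNReal.toReal_pos (zero_lt_one.trans_le hq).ne' hq'
  simp [lqNorm, PiLp.norm_eq_sum h]

theorem one_le_toReal (hq : 1 ≤ q) (hq' : q ≠ ∞) : 1 ≤ q.toReal := by
  simpa using ENNReal.toReal_mono hq' hq

/-- The power-mean inequality over `d` coordinates. It turns the `ℓ_q` diameter of `Θ` into an `ℓ_1`
diameter, the one that Laplace noise sees. -/
theorem lqNorm_one_le (hq : 1 ≤ q) (v : Fin d → ℝ) :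
    lqNorm 1 v ≤ (d : ℝ) ^ (1 - (q⁻¹).toReal) * lqNorm q v := by
  rcases eq_or_ne q ∞ with rfl | hq'
  · have hle : ∀ i, |v i| ≤ lqNorm ∞ v := fun i =>
      PiLp.norm_apply_le (WithLp.toLp ∞ v : PiLp ∞ fun _ : Fin d => ℝ) i
    simpa [lqNorm_one] using Finset.sum_le_sum fun i (_ : i ∈ Finset.univ) => hle i
  · have h1 := one_le_toReal hq hq'
    have h0 : 0 < q.toReal := zero_lt_one.trans_le h1
    have hsum : 0 ≤ ∑ i, |v i| := Finset.sum_nonneg fun i _ => abs_nonneg _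
    have hsum' : 0 ≤ ∑ i, |v i| ^ q.toReal :=
      Finset.sum_nonneg fun i _ => Real.rpow_nonneg (abs_nonneg _) _
    have hpow := Real.rpow_sum_le_const_mul_sum_rpow Finset.univ v h1
    rw [Finset.card_univ, Fintype.card_fin] at hpow
    have hroot := Real.rpow_le_rpow (Real.rpow_nonneg hsum _) hpow (inv_nonneg.2 h0.le)
    rw [Real.rpow_rpow_inv hsum h0.ne', Real.mul_rpow (by positivity) hsum',
      ← Real.rpow_mul (Nat.cast_nonneg d)] at hroot
    rw [lqNorm_one, lqNorm_eq_sum hq hq', ENNReal.toReal_inv, one_div]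
    convert hroot using 3
    field_simp

end Norm

/-! ### Geometry of `ℓ_q` balls. -/

section Ball

variable {d : ℕ} {q : ℝ≥0∞} {c : Fin d → ℝ} {ρ : ℝ}

theorem lqNorm_sub_le_of_mem_lqBall (hq : 1 ≤ q) {x y : Fin d → ℝ}
    (hx : x ∈ lqBall q c ρ) (hy : y ∈ lqBall q c ρ) : lqNorm q (x - y) ≤ 2 * ρ := by
  have h := lqNorm_add_le hq (x - c) (c - y)
  rw [sub_add_sub_cancel, lqNorm_sub_rev hq c y] at h
  have h1 : lqNorm q (x - c) ≤ ρ := hx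
  have h2 : lqNorm q (y - c) ≤ ρ := hy
  linarith

theorem convex_lqBall (hq : 1 ≤ q) : Convex ℝ (lqBall q c ρ) := by
  intro x hx y hy a b ha hb hab
  have h : a • x + b • y - c = a • (x - c) + b • (y - c) := by
    have hc : c = a • c + b • c := by rw [← add_smul, hab, one_smul]
    nth_rewrite 1 [hc]
    module
  change lqNorm q (a • x + b • y - c) ≤ ρ
  have hx' : lqNorm q (x - c) ≤ ρ := hx
  have hy' : lqNorm q (y - c) ≤ ρ := hy
  calc lqNorm q (a • x + b • y - c) ≤ a * lqNorm q (x - c) + b * lqNorm q (y - c) := by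
        rw [h]
        refine (lqNorm_add_le hq _ _).trans_eq ?_
        rw [lqNorm_smul hq, lqNorm_smul hq, abs_of_nonneg ha, abs_of_nonneg hb]
    _ ≤ a * ρ + b * ρ := by gcongr
    _ = ρ := by rw [← add_mul, hab, one_mul]

theorem isCompact_lqBall (hq : 1 ≤ q) : IsCompact (lqBall q c ρ) := by
  have : Fact (1 ≤ q) := ⟨hq⟩
  have h := (isCompact_closedBall (WithLp.toLp q c : PiLp q fun _ : Fin d => ℝ) ρ).image
    (PiLp.continuous_ofLp q _)
  convert h using 1
  ext x
  constructor
  · intro hx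
    refine ⟨WithLp.toLp q x, ?_, rfl⟩
    rw [Metric.mem_closedBall, dist_eq_norm]
    exact hx
  · rintro ⟨y, hy, rfl⟩
    rw [Metric.mem_closedBall, dist_eq_norm] at hy
    exact hy

theorem volume_lqBall_ne_zero (hq : 1 ≤ q) (hρ : 0 < ρ) : volume (lqBall q c ρ) ≠ 0 := by
  have hcont : Continuous fun x : Fin d → ℝ => lqNorm q (x - c) :=
    (continuous_lqNorm hq).comp (continuous_id.sub continuous_const)
  have hopen : IsOpen {x : Fin d → ℝ | lqNorm q (x - c) < ρ} :=
    isOpen_lt hcont continuous_const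
  have hpos : 0 < volume {x : Fin d → ℝ | lqNorm q (x - c) < ρ} :=
    hopen.measure_pos volume ⟨c, by simpa [lqNorm_zero hq] using hρ⟩
  exact (hpos.trans_le (measure_mono fun x (hx : lqNorm q (x - c) < ρ) => hx.le)).ne'

end Ball

/-! ### The one-dimensional Laplace law: moments and translations. -/

section Laplace

theorem measurable_laplaceDensity (b : ℝ) :
    Measurable fun x : ℝ => ENNReal.ofReal (Real.exp (-|x| / b) / (2 * b)) := by
  fun_prop

theorem integrable_abs_rpow_mul_laplaceDensity {b s : ℝ} (hb : 0 < b) (hs : 0 ≤ s) :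
    Integrable (fun x : ℝ => |x| ^ s * (Real.exp (-|x| / b) / (2 * b))) ∧
      ∫ x : ℝ, |x| ^ s * (Real.exp (-|x| / b) / (2 * b)) = b ^ s * Real.Gamma (s + 1) := by
  have hcongr : ∀ x : ℝ, x ^ s * (Real.exp (-x / b) / (2 * b)) =
      (2 * b)⁻¹ * (x ^ s * Real.exp (-b⁻¹ * x)) := by
    intro x
    rw [neg_div, div_eq_inv_mul x, neg_mul]; ring
  have hhalf : IntegrableOn (fun x : ℝ => x ^ s * (Real.exp (-x / b) / (2 * b)))
      (Set.Ioi 0) := by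
    simp_rw [hcongr]
    have := integrableOn_rpow_mul_exp_neg_mul_rpow (p := 1) (s := s) (b := b⁻¹)
      (by linarith) one_pos (inv_pos.2 hb)
    simp_rw [Real.rpow_one] at this
    exact this.const_mul _
  refine ⟨?_, ?_⟩
  · have hpos : IntegrableOn (fun x : ℝ => |x| ^ s * (Real.exp (-|x| / b) / (2 * b)))
        (Set.Ioi 0) :=
      hhalf.congr_fun (fun x hx => by simp only [abs_of_pos (Set.mem_Ioi.1 hx)]) measurableSet_Ioi
    have hneg := hpos.comp_neg
    simp only [abs_neg, Set.neg_Ioi, neg_zero] at hneg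
    rw [← integrableOn_univ, ← Set.Iic_union_Ioi (a := (0 : ℝ))]
    exact ((integrableOn_Iic_iff_integrableOn_Iio (by finiteness)).2 hneg).union hpos
  · rw [integral_comp_abs (f := fun x : ℝ => x ^ s * (Real.exp (-x / b) / (2 * b)))]
    simp_rw [hcongr]
    rw [integral_const_mul]
    have := Real.integral_rpow_mul_exp_neg_mul_Ioi (a := s + 1) (r := b⁻¹) (by linarith)
      (inv_pos.2 hb)
    simp_rw [add_sub_cancel_right, ← neg_mul] at this
    rw [this, one_div, inv_inv, Real.rpow_add hb, Real.rpow_one]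
    field_simp

theorem isProbabilityMeasure_laplace {b : ℝ} (hb : 0 ≤ b) :
    IsProbabilityMeasure (laplace b) := by
  rcases hb.eq_or_lt with rfl | hb
  · simp only [laplace, if_true]; infer_instance
  · obtain ⟨hi, he⟩ := integrable_abs_rpow_mul_laplaceDensity hb le_rfl
    simp only [Real.rpow_zero, one_mul, zero_add, Real.Gamma_one] at hi he
    refine ⟨?_⟩
    rw [laplace, if_neg hb.ne', withDensity_apply _ MeasurableSet.univ, setLIntegral_univ,
      ← ofReal_integral_eq_lintegral_ofReal hi (ae_of_all _ fun x => by positivity), he]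
    simp

theorem integral_abs_rpow_laplace {b s : ℝ} (hb : 0 ≤ b) (hs : 0 < s) :
    Integrable (fun x : ℝ => |x| ^ s) (laplace b) ∧
      ∫ x : ℝ, |x| ^ s ∂laplace b = b ^ s * Real.Gamma (s + 1) := by
  rcases hb.eq_or_lt with rfl | hb
  · simp only [laplace, if_true]
    refine ⟨integrable_dirac (by simp), ?_⟩
    simp [Real.zero_rpow hs.ne']
  · obtain ⟨hi, he⟩ := integrable_abs_rpow_mul_laplaceDensity hb hs.le
    have hdens : ∀ x : ℝ, (ENNReal.ofReal (Real.exp (-|x| / b) / (2 * b))).toReal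
        = Real.exp (-|x| / b) / (2 * b) := fun x => ENNReal.toReal_ofReal (by positivity)
    rw [laplace, if_neg hb.ne']
    refine ⟨?_, ?_⟩
    · rw [integrable_withDensity_iff (measurable_laplaceDensity b) (by simp)]
      simpa only [hdens] using hi
    · rw [integral_withDensity_eq_integral_toReal_smul (measurable_laplaceDensity b) (by simp)]
      simp_rw [hdens, smul_eq_mul, mul_comm _ (|_| ^ s)]
      exact he

theorem integral_abs_laplace {b : ℝ} (hb : 0 ≤ b) :
    Integrable (fun x : ℝ => |x|) (laplace b) ∧ ∫ x : ℝ, |x| ∂laplace b = b := by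
  simpa [Real.Gamma_two, one_add_one_eq_two] using integral_abs_rpow_laplace hb one_pos

/-- After translation of the integration variable, the densities at `x` and `a + x` are compared
pointwise; their ratio is controlled by `|a + x| ≤ |a| + |x|`. -/
theorem map_add_laplace_le {b : ℝ} (hb : 0 < b) (a : ℝ) :
    (laplace b).map (a + ·) ≤ ENNReal.ofReal (Real.exp (|a| / b)) • laplace b := by
  refine Measure.le_iff.2 fun S hS => ?_
  have hpre : MeasurableSet ((a + ·) ⁻¹' S) := measurable_const_add a hS
  rw [Measure.map_apply (measurable_const_add a) hS, Measure.smul_apply, smul_eq_mul, laplace,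
    if_neg hb.ne', withDensity_apply _ hpre, withDensity_apply _ hS,
    ← lintegral_const_mul _ (measurable_laplaceDensity b), ← lintegral_indicator hpre,
    ← lintegral_indicator hS,
    ← lintegral_add_left_eq_self (S.indicator _) a]
  refine lintegral_mono fun x => ?_
  by_cases hx : a + x ∈ S
  · rw [Set.indicator_of_mem (show x ∈ (a + ·) ⁻¹' S from hx), Set.indicator_of_mem hx,
      ← ENNReal.ofReal_mul (Real.exp_pos _).le]
    refine ENNReal.ofReal_le_ofReal ?_
    rw [← mul_div_assoc, ← Real.exp_add, ← add_div]
    gcongr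
    have := abs_add_le a x
    linarith
  · rw [Set.indicator_of_notMem (show x ∉ (a + ·) ⁻¹' S from hx), Set.indicator_of_notMem hx]

end Laplace

/-- Domination of the factors, up to constants, gives domination of the product measures. -/
theorem pi_le_smul_pi {ι : Type*} [Fintype ι] {α : ι → Type*} [∀ i, MeasurableSpace (α i)]
    {μ ν : ∀ i, Measure (α i)} [∀ i, SigmaFinite (μ i)] {k : ι → ℝ≥0∞}
    (hk0 : ∀ i, k i ≠ 0) (hk : ∀ i, k i ≠ ∞) (h : ∀ i, μ i ≤ k i • ν i) :
    Measure.pi μ ≤ (∏ i, k i) • Measure.pi ν := by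
  have hK0 : ∏ i, k i ≠ 0 := Finset.prod_ne_zero_iff.2 fun i _ => hk0 i
  have hK : ∏ i, k i ≠ ∞ := ENNReal.prod_ne_top fun i _ => hk i
  have hout : ((∏ i, k i)⁻¹ • Measure.pi μ).toOuterMeasure ≤
      OuterMeasure.pi fun i => (ν i).toOuterMeasure := by
    -- The product outer measure is the largest one bounded by the products on boxes, so boxes
    -- suffice.
    refine OuterMeasure.le_pi.2 fun s _ => ?_
    change (∏ i, k i)⁻¹ * Measure.pi μ (Set.univ.pi s) ≤ _
    rw [Measure.pi_pi, mul_comm, ← div_eq_mul_inv, ENNReal.div_le_iff hK0 hK, mul_comm,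
      ← Finset.prod_mul_distrib]
    exact Finset.prod_le_prod' fun i _ => h i (s i)
  refine Measure.le_iff.2 fun S hS => ?_
  have h1 : (∏ i, k i)⁻¹ * Measure.pi μ S ≤ Measure.pi ν S := by
    refine (hout S).trans ?_
    rw [Measure.pi_def]
    exact le_toMeasure_apply _ _ _
  rw [Measure.smul_apply, smul_eq_mul]
  calc Measure.pi μ S = (∏ i, k i) * ((∏ i, k i)⁻¹ * Measure.pi μ S) := by
        rw [← mul_assoc, ENNReal.mul_inv_cancel hK0 hK, one_mul]
    _ ≤ _ := by gcongr

/-! ### Laplace noise in `ℝ^d`. -/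

section LaplaceVec

variable {d : ℕ} {b : ℝ}

theorem isProbabilityMeasure_laplaceVec (hb : 0 ≤ b) :
    IsProbabilityMeasure (laplaceVec d b) := by
  have := isProbabilityMeasure_laplace hb
  unfold laplaceVec
  infer_instance

theorem map_add_laplaceVec_le (hb : 0 < b) (a : Fin d → ℝ) :
    (laplaceVec d b).map (a + ·) ≤
      ENNReal.ofReal (Real.exp (lqNorm 1 a / b)) • laplaceVec d b := by
  have := isProbabilityMeasure_laplace hb.le
  have : ∀ i : Fin d, IsProbabilityMeasure ((laplace b).map (a i + ·)) := fun i =>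
    Measure.isProbabilityMeasure_map (measurable_const_add (a i)).aemeasurable
  have hmap : (laplaceVec d b).map (a + ·) = Measure.pi fun i => (laplace b).map (a i + ·) :=
    Measure.pi_map_pi (f := fun i x => a i + x) fun i => (measurable_const_add (a i)).aemeasurable
  have hconst : ENNReal.ofReal (Real.exp (lqNorm 1 a / b)) =
      ∏ i, ENNReal.ofReal (Real.exp (|a i| / b)) := by
    rw [lqNorm_one, Finset.sum_div, Real.exp_sum,
      ENNReal.ofReal_prod_of_nonneg fun i _ => (Real.exp_pos _).le]
  rw [hmap, hconst]
  exact pi_le_smul_pi (fun i => by simp [Real.exp_pos]) (fun i => ENNReal.ofReal_ne_top)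
    fun i => map_add_laplace_le hb (a i)

theorem laplaceVec_translate_le (hb : 0 < b) {S : Set (Fin d → ℝ)} (hS : MeasurableSet S)
    (x y : Fin d → ℝ) :
    (laplaceVec d b).real ((x + ·) ⁻¹' S) ≤
      Real.exp (lqNorm 1 (x - y) / b) * (laplaceVec d b).real ((y + ·) ⁻¹' S) := by
  have := isProbabilityMeasure_laplaceVec (d := d) hb.le
  have hpre : MeasurableSet ((y + ·) ⁻¹' S) := measurable_const_add y hS
  have h := map_add_laplaceVec_le hb (x - y) ((y + ·) ⁻¹' S)
  have hset : (x - y + ·) ⁻¹' ((y + ·) ⁻¹' S) = (x + ·) ⁻¹' S := by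
    ext z
    simp [← add_assoc]
  rw [Measure.map_apply (measurable_const_add _) hpre, hset, Measure.smul_apply,
    smul_eq_mul] at h
  have := ENNReal.toReal_mono (ENNReal.mul_ne_top ENNReal.ofReal_ne_top
    (measure_ne_top _ _)) h
  rwa [ENNReal.toReal_mul, ENNReal.toReal_ofReal (Real.exp_pos _).le] at this

/-- Squeezed between the two multiplicative translation bounds. Continuity holds for every
measurable `S`, which later permits the intermediate value theorem. -/
theorem continuous_laplaceVec_translate (hb : 0 < b) {S : Set (Fin d → ℝ)}
    (hS : MeasurableSet S) :
    Continuous fun x => (laplaceVec d b).real ((x + ·) ⁻¹' S) := by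
  refine continuous_iff_continuousAt.2 fun x => ?_
  set h := fun x => (laplaceVec d b).real ((x + ·) ⁻¹' S) with hh
  have hN : Continuous fun y : Fin d → ℝ => lqNorm 1 (y - x) / b :=
    ((continuous_lqNorm le_rfl).comp (continuous_id.sub continuous_const)).div_const b
  have hup : Continuous fun y : Fin d → ℝ => Real.exp (lqNorm 1 (y - x) / b) * h x :=
    (Real.continuous_exp.comp hN).mul continuous_const
  have hlo : Continuous fun y : Fin d → ℝ => (Real.exp (lqNorm 1 (y - x) / b))⁻¹ * h x :=
    ((Real.continuous_exp.comp hN).inv₀ fun y => (Real.exp_pos _).ne').mul continuous_const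
  refine tendsto_of_tendsto_of_tendsto_of_le_of_le
    (by simpa [ContinuousAt, lqNorm_zero] using hlo.continuousAt (x := x))
    (by simpa [ContinuousAt, lqNorm_zero] using hup.continuousAt (x := x))
    (fun y => ?_) (fun y => laplaceVec_translate_le hb hS y x)
  have := laplaceVec_translate_le hb hS x y
  rw [lqNorm_sub_rev le_rfl] at this
  exact (inv_mul_le_iff₀ (Real.exp_pos _)).2 this

theorem integral_lqNorm_one_laplaceVec (hb : 0 ≤ b) :
    Integrable (lqNorm 1) (laplaceVec d b) ∧ ∫ z, lqNorm 1 z ∂laplaceVec d b = d * b := by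
  have := isProbabilityMeasure_laplace hb
  obtain ⟨hi, he⟩ := integral_abs_laplace hb
  have hi' : ∀ i : Fin d, Integrable (fun z : Fin d → ℝ => |z i|) (laplaceVec d b) := fun i =>
    integrable_comp_eval (μ := fun _ : Fin d => laplace b) (i := i) hi
  have he' : ∀ i : Fin d, ∫ z : Fin d → ℝ, |z i| ∂laplaceVec d b = b := fun i =>
    (integral_comp_eval (μ := fun _ : Fin d => laplace b) (i := i)
      hi.aestronglyMeasurable).trans he
  have hfun : (lqNorm 1 : (Fin d → ℝ) → ℝ) = fun z => ∑ i, |z i| := funext lqNorm_one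
  rw [hfun]
  refine ⟨integrable_finsetSum _ fun i _ => hi' i, ?_⟩
  rw [integral_finsetSum _ fun i _ => hi' i]
  simp [he']

end LaplaceVec

/-! ### Mixing with the uniform law. -/

section Mixture

variable {d : ℕ} {Θ : Set (Fin d → ℝ)}

theorem isProbabilityMeasure_unif {E : Type*} [MeasureSpace E] {S : Set E}
    (h0 : volume S ≠ 0) (h : volume S ≠ ∞) : IsProbabilityMeasure (unif S) :=
  cond_isProbabilityMeasure_of_finite h0 h

theorem isProbabilityMeasure_unif_Icc :
    IsProbabilityMeasure (unif (Set.Icc (0 : ℝ) 1)) :=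
  isProbabilityMeasure_unif (by simp) (by simp)

/-- By convexity the shrunken copy stays inside `Θ`, so no mass is lost and only the volume scaling
remains. -/
theorem unif_real_image_homothety (h0 : volume Θ ≠ 0) (h : volume Θ ≠ ∞)
    (hmeas : MeasurableSet Θ) (hconv : Convex ℝ Θ) {w : Fin d → ℝ} (hw : w ∈ Θ) {r : ℝ}
    (hr0 : 0 ≤ r) (hr1 : r ≤ 1) :
    (unif Θ).real (AffineMap.homothety w r '' Θ) = r ^ d := by
  have hsub : AffineMap.homothety w r '' Θ ⊆ Θ := by
    rintro _ ⟨v, hv, rfl⟩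
    rw [AffineMap.homothety_eq_lineMap]
    exact hconv.lineMap_mem hw hv ⟨hr0, hr1⟩
  rw [measureReal_def, unif, cond_apply hmeas, Set.inter_eq_self_of_subset_right hsub,
    Measure.addHaar_image_homothety, Module.finrank_fin_fun, mul_left_comm,
    ENNReal.inv_mul_cancel h0 h, mul_one, abs_of_nonneg (pow_nonneg hr0 d),
    ENNReal.toReal_ofReal (pow_nonneg hr0 d)]

/-- The superlevel sets of a function `h` that varies by a factor of at most `κ` over the scale
`r * D`, under the mixtures of `(ε, δ)`-close laws on `Θ` with the uniform law on `Θ`: a homothetic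
copy of `Θ` of ratio `r` separates `{t < h}` from the complement of `{t ≤ κ ^ 2 * h}`, and its
uniform mass pays for the term `δ`. -/
theorem mixture_superlevel_le (h0 : volume Θ ≠ 0) (hfin : volume Θ ≠ ∞)
    (hmeas : MeasurableSet Θ) (hconv : Convex ℝ Θ)
    {P Q : Measure (Fin d → ℝ)} [IsProbabilityMeasure P] [IsProbabilityMeasure Q]
    (hP : ∀ᵐ x ∂P, x ∈ Θ) (hQ : ∀ᵐ x ∂Q, x ∈ Θ) {ε δ ω r D κ t : ℝ} (hε : 0 ≤ ε)
    (hω : 0 < ω) (hω1 : ω ≤ 1) (hδ : 0 ≤ δ)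
    (hPQ : ∀ S, MeasurableSet S → P.real S ≤ Real.exp ε * Q.real S + δ)
    (hr : 0 ≤ r) (hrd : r ^ d = δ / ω) (hD : ∀ x ∈ Θ, ∀ y ∈ Θ, lqNorm 1 (x - y) ≤ D)
    {h : (Fin d → ℝ) → ℝ} (hc : Continuous h) (hκ : 1 ≤ κ)
    (hh : ∀ x y, lqNorm 1 (x - y) ≤ r * D → h x ≤ κ * h y) (ht : 0 < t) :
    (1 - ω) * P.real {x | t < h x} + ω * (unif Θ).real {x | t < h x} ≤
      Real.exp ε * ((1 - ω) * Q.real {x | t ≤ κ ^ 2 * h x} +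
        ω * (unif Θ).real {x | t ≤ κ ^ 2 * h x}) := by
  have := isProbabilityMeasure_unif h0 hfin
  set U := unif Θ with hU
  have hUΘ : ∀ᵐ x ∂U, x ∈ Θ := ae_cond_mem hmeas
  set S := {x | t < h x} with hS
  set T := {x | t ≤ κ ^ 2 * h x} with hT
  have hω' : 0 ≤ 1 - ω := by linarith
  have hexp : 1 ≤ Real.exp ε := Real.one_le_exp hε
  have hSm : MeasurableSet S := (isOpen_lt continuous_const hc).measurableSet
  have hκ0 : 0 < κ := by linarith
  have hST : S ⊆ T := fun x (hx : t < h x) => by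
    have : 1 * h x ≤ κ ^ 2 * h x :=
      mul_le_mul_of_nonneg_right (one_le_pow₀ hκ) (ht.trans hx).le
    exact (by linarith : t ≤ κ ^ 2 * h x)
  -- If `S` misses `Θ`, the left side vanishes.
  by_cases hSΘ : ∃ x ∈ Θ, x ∈ S
  swap
  · have hempty : ∀ μ : Measure (Fin d → ℝ), (∀ᵐ x ∂μ, x ∈ Θ) → μ.real S = 0 := by
      intro μ hμ
      have : μ S = 0 := measure_mono_null (fun x hx hxΘ => hSΘ ⟨x, hxΘ, hx⟩) hμ
      simp [measureReal_def, this]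
    rw [hempty P hP, hempty U hUΘ]
    simp only [mul_zero, add_zero]
    positivity
  -- If `T` contains `Θ`, the right side is `exp ε ≥ 1`.
  by_cases hΘT : ∃ y ∈ Θ, y ∉ T
  swap
  · have hfull : ∀ μ : Measure (Fin d → ℝ), [IsProbabilityMeasure μ] → (∀ᵐ x ∂μ, x ∈ Θ) →
        μ.real T = 1 := by
      intro μ _ hμ
      have : μ T = 1 := by
        rw [← measure_univ (μ := μ)]
        refine measure_eq_measure_of_null_sdiff (Set.subset_univ _) ?_
        exact measure_mono_null (fun x hx hxΘ => hΘT ⟨x, hxΘ, hx.2⟩) hμ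
      simp [measureReal_def, this]
    rw [hfull Q hQ, hfull U hUΘ]
    have h1 : P.real S ≤ 1 := measureReal_le_one
    have h2 : U.real S ≤ 1 := measureReal_le_one
    nlinarith
  obtain ⟨x, hxΘ, hxS⟩ := hSΘ
  obtain ⟨y, hyΘ, hyT⟩ := hΘT
  have hxS' : t < h x := hxS
  have hyT' : κ ^ 2 * h y < t := not_le.1 hyT
  have htκ : t / κ ≤ t := div_le_self ht.le hκ
  have hyκ : κ * h y < t / κ := by rw [lt_div_iff₀ hκ0]; linarith
  -- `h` may be negative here, so `h y ≤ κ * h y` is available only when `h y > 0`.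
  have hyκ' : h y ≤ t / κ := by
    rcases le_or_gt (h y) 0 with hy | hy
    · exact hy.trans (by positivity)
    · nlinarith
  obtain ⟨w, hwΘ, hw⟩ : t / κ ∈ h '' Θ :=
    hconv.isPreconnected.intermediate_value hyΘ hxΘ hc.continuousOn ⟨hyκ', by linarith⟩
  have hD0 : 0 ≤ D := (lqNorm_nonneg le_rfl _).trans (hD x hxΘ y hyΘ)
  -- Otherwise the variation bound would apply to `x` and `y` themselves, giving `h x ≤ κ * h y <
  -- t`.
  have hr1 : r ≤ 1 := by
    by_contra hr1
    have := hh x y ((hD x hxΘ y hyΘ).trans (le_mul_of_one_le_left hD0 (not_le.1 hr1).le))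
    linarith
  set A := AffineMap.homothety w r '' Θ with hA
  have hwκ : κ * h w = t := by rw [hw]; field_simp
  have hdist : ∀ u ∈ A, lqNorm 1 (u - w) ≤ r * D := by
    rintro _ ⟨v, hv, rfl⟩
    rw [AffineMap.homothety_apply, vsub_eq_sub, vadd_eq_add, add_sub_cancel_right,
      lqNorm_smul le_rfl, abs_of_nonneg hr]
    exact mul_le_mul_of_nonneg_left (hD v hv w hwΘ) hr
  have hAS : Disjoint A S := Set.disjoint_left.2 fun u hu (huS : t < h u) => by
    have := hh u w (hdist u hu)
    linarith
  have hAT : A ⊆ T := fun u hu => by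
    have := hh w u (by rw [lqNorm_sub_rev le_rfl]; exact hdist u hu)
    have h2 : κ * h w ≤ κ * (κ * h u) := mul_le_mul_of_nonneg_left this hκ0.le
    exact (by linarith : t ≤ κ ^ 2 * h u)
  have hUA : ω * U.real A = δ := by
    rw [hA, unif_real_image_homothety h0 hfin hmeas hconv hwΘ hr hr1, hrd]
    field_simp
  have hUT : U.real A + U.real S ≤ U.real T := by
    rw [← measureReal_union hAS hSm]
    exact measureReal_mono (Set.union_subset hAT hST)
  have hQST : Q.real S ≤ Q.real T := measureReal_mono hST
  calc (1 - ω) * P.real S + ω * U.real S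
      ≤ (1 - ω) * (Real.exp ε * Q.real T + δ) + ω * U.real S := by
        have := hPQ S hSm
        gcongr
        exact this.trans (by gcongr)
    -- The error is paid here: `(1 - ω) * δ ≤ δ = ω * U.real A`.
    _ ≤ Real.exp ε * ((1 - ω) * Q.real T) + ω * (U.real A + U.real S) := by nlinarith
    _ ≤ Real.exp ε * ((1 - ω) * Q.real T) + Real.exp ε * (ω * U.real T) := by
        exact add_le_add_right ((mul_le_mul_of_nonneg_left hUT hω.le).trans
          (le_mul_of_one_le_left (by positivity) hexp)) _
    _ = _ := by ring

/-- The mixture of `μ` and `ν` with weights `1 - ω` and `ω`. -/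
noncomputable def mixture {E : Type*} [MeasurableSpace E] (ω : ℝ) (μ ν : Measure E) : Measure E :=
  ENNReal.ofReal (1 - ω) • μ + ENNReal.ofReal ω • ν

theorem mixture_apply {E : Type*} [MeasurableSpace E] {ω : ℝ} (hω : 0 ≤ ω) (hω1 : ω ≤ 1)
    (μ ν : Measure E) [IsFiniteMeasure μ] [IsFiniteMeasure ν] (S : Set E) :
    mixture ω μ ν S = ENNReal.ofReal ((1 - ω) * μ.real S + ω * ν.real S) := by
  have : 0 ≤ 1 - ω := by linarith
  rw [ENNReal.ofReal_add (by positivity) (by positivity), ENNReal.ofReal_mul this,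
    ENNReal.ofReal_mul hω, ofReal_measureReal, ofReal_measureReal]
  simp [mixture]

theorem lintegral_unif_Icc_ite {ω : ℝ} (hω : 0 ≤ ω) (hω1 : ω ≤ 1) (a b : ℝ≥0∞) :
    ∫⁻ t, (if t ≤ ω then a else b) ∂unif (Set.Icc (0 : ℝ) 1) =
      ENNReal.ofReal (1 - ω) * b + ENNReal.ofReal ω * a := by
  have hfun : (fun t : ℝ => if t ≤ ω then a else b) =
      fun t => (Set.Iic ω).indicator (fun _ => a) t + (Set.Ioi ω).indicator (fun _ => b) t := by
    ext t
    by_cases ht : t ≤ ω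
    · simp [ht]
    · simp [ht, not_le.1 ht]
  rw [hfun, lintegral_add_left (measurable_const.indicator measurableSet_Iic),
    lintegral_indicator_const measurableSet_Iic, lintegral_indicator_const measurableSet_Ioi,
    unif, cond_apply measurableSet_Icc, cond_apply measurableSet_Icc]
  have h1 : Set.Icc (0 : ℝ) 1 ∩ Set.Iic ω = Set.Icc 0 ω := by
    ext t; simp only [Set.mem_inter_iff, Set.mem_Icc, Set.mem_Iic]; grind
  have h2 : Set.Icc (0 : ℝ) 1 ∩ Set.Ioi ω = Set.Ioc ω 1 := by
    ext t; simp only [Set.mem_inter_iff, Set.mem_Icc, Set.mem_Ioi, Set.mem_Ioc]; grind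
  rw [h1, h2]
  simp [mul_comm, add_comm]

end Mixture

/-! ### Pure privacy of the purified law. -/

section Privacy

variable {d : ℕ} {q : ℝ≥0∞} {R ε' δ ω : ℝ} {Θ : Set (Fin d → ℝ)}

theorem measurable_purifyPoint :
    Measurable fun s : (Fin d → ℝ) × ℝ × (Fin d → ℝ) × (Fin d → ℝ) =>
      purifyPoint ω s.1 s.2.1 s.2.2.1 s.2.2.2 := by
  unfold purifyPoint
  refine Measurable.add (Measurable.ite ?_ (by fun_prop) (by fun_prop)) (by fun_prop)
  exact measurableSet_le (by fun_prop) (by fun_prop)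

/-- Fubini: integrating out the noise and then the coin leaves a test function integrated against a
mixture, the form needed for the layer-cake argument. -/
theorem purify_apply (hω : 0 ≤ ω) (hω1 : ω ≤ 1)
    [IsProbabilityMeasure (unif Θ)]
    [IsProbabilityMeasure (laplaceVec d (2 * noiseDelta d q R δ ω / ε'))]
    (μ : Measure (Fin d → ℝ)) [IsProbabilityMeasure μ] {S : Set (Fin d → ℝ)}
    (hS : MeasurableSet S) :
    purify q R ε' δ ω Θ μ S =
      ∫⁻ x, laplaceVec d (2 * noiseDelta d q R δ ω / ε') ((x + ·) ⁻¹' S)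
        ∂mixture ω μ (unif Θ) := by
  have := isProbabilityMeasure_unif_Icc
  set L := laplaceVec d (2 * noiseDelta d q R δ ω / ε')
  have hmeas := measurable_purifyPoint (d := d) (ω := ω)
  have hadd : MeasurableSet {p : (Fin d → ℝ) × (Fin d → ℝ) | p.1 + p.2 ∈ S} :=
    (measurable_fst.add measurable_snd) hS
  have hL : Measurable fun x => L ((x + ·) ⁻¹' S) := measurable_measure_prodMk_left hadd
  rw [purify, purifyJoint, Measure.map_map measurable_snd (measurable_fst.prodMk hmeas),
    Measure.map_apply (measurable_snd.comp (measurable_fst.prodMk hmeas)) hS]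
  have hpre := hmeas hS
  change (μ.prod ((unif (Set.Icc (0 : ℝ) 1)).prod ((unif Θ).prod L)))
    ((fun s => purifyPoint ω s.1 s.2.1 s.2.2.1 s.2.2.2) ⁻¹' S) = _
  rw [Measure.prod_apply hpre]
  have hinner : ∀ x : Fin d → ℝ,
      ((unif (Set.Icc (0 : ℝ) 1)).prod ((unif Θ).prod L)) (Prod.mk x ⁻¹'
        ((fun s : (Fin d → ℝ) × ℝ × (Fin d → ℝ) × (Fin d → ℝ) =>
          purifyPoint ω s.1 s.2.1 s.2.2.1 s.2.2.2) ⁻¹' S)) =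
      ENNReal.ofReal (1 - ω) * L ((x + ·) ⁻¹' S) +
        ENNReal.ofReal ω * ∫⁻ y, L ((y + ·) ⁻¹' S) ∂unif Θ := by
    intro x
    have hx := measurable_prodMk_left (x := x) hpre
    rw [Measure.prod_apply hx, ← lintegral_unif_Icc_ite hω hω1]
    refine lintegral_congr fun t => ?_
    rw [Measure.prod_apply (measurable_prodMk_left (x := t) hx)]
    by_cases ht : t ≤ ω
    · rw [if_pos ht]
      refine lintegral_congr fun y => ?_
      congr 1
      ext z
      simp [purifyPoint, ht]
    · rw [if_neg ht]
      have hcongr : ∀ y : Fin d → ℝ, L (Prod.mk y ⁻¹' (Prod.mk t ⁻¹' (Prod.mk x ⁻¹'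
        ((fun s : (Fin d → ℝ) × ℝ × (Fin d → ℝ) × (Fin d → ℝ) =>
          purifyPoint ω s.1 s.2.1 s.2.2.1 s.2.2.2) ⁻¹' S)))) = L ((x + ·) ⁻¹' S) := by
        intro y
        congr 1
        ext z
        simp [purifyPoint, ht]
      simp [hcongr]
  simp_rw [hinner]
  rw [lintegral_add_right _ measurable_const, lintegral_const_mul _ hL, lintegral_const,
    measure_univ, mul_one, mixture, lintegral_add_measure, lintegral_smul_measure,
    lintegral_smul_measure, smul_eq_mul, smul_eq_mul]

theorem isProbabilityMeasure_purify [IsProbabilityMeasure (unif Θ)]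
    [IsProbabilityMeasure (laplaceVec d (2 * noiseDelta d q R δ ω / ε'))]
    (μ : Measure (Fin d → ℝ)) [IsProbabilityMeasure μ] :
    IsProbabilityMeasure (purify q R ε' δ ω Θ μ) := by
  have := isProbabilityMeasure_unif_Icc
  have : IsProbabilityMeasure (purifyJoint q R ε' δ ω Θ μ) :=
    Measure.isProbabilityMeasure_map (measurable_fst.prodMk measurable_purifyPoint).aemeasurable
  exact Measure.isProbabilityMeasure_map measurable_snd.aemeasurable

theorem noiseDelta_nonneg (hR : 0 ≤ R) (hδ : 0 ≤ δ) (hω : 0 ≤ ω) :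
    0 ≤ noiseDelta d q R δ ω := by
  unfold noiseDelta
  positivity

/-- The mixtures are related as measures once noise that smooths at the right scale is added. -/
theorem lintegral_mixture_le (h0 : volume Θ ≠ 0) (hfin : volume Θ ≠ ∞)
    (hmeas : MeasurableSet Θ) (hconv : Convex ℝ Θ)
    {P Q : Measure (Fin d → ℝ)} [IsProbabilityMeasure P] [IsProbabilityMeasure Q]
    (hP : ∀ᵐ x ∂P, x ∈ Θ) (hQ : ∀ᵐ x ∂Q, x ∈ Θ) {ε r D κ : ℝ} (hε : 0 ≤ ε)
    (hω : 0 < ω) (hω1 : ω ≤ 1) (hδ : 0 ≤ δ)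
    (hPQ : ∀ S, MeasurableSet S → P.real S ≤ Real.exp ε * Q.real S + δ)
    (hr : 0 ≤ r) (hrd : r ^ d = δ / ω) (hD : ∀ x ∈ Θ, ∀ y ∈ Θ, lqNorm 1 (x - y) ≤ D)
    {h : (Fin d → ℝ) → ℝ} (hc : Continuous h) (hnn : ∀ x, 0 ≤ h x) (hκ : 1 ≤ κ)
    (hh : ∀ x y, lqNorm 1 (x - y) ≤ r * D → h x ≤ κ * h y) :
    ∫⁻ x, ENNReal.ofReal (h x) ∂mixture ω P (unif Θ) ≤
      ENNReal.ofReal (Real.exp ε * κ ^ 2) *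
        ∫⁻ x, ENNReal.ofReal (h x) ∂mixture ω Q (unif Θ) := by
  have := isProbabilityMeasure_unif h0 hfin
  have hκ2 : 0 ≤ κ ^ 2 := sq_nonneg κ
  have hc2 : Continuous fun x => κ ^ 2 * h x := continuous_const.mul hc
  have hscale : ENNReal.ofReal (Real.exp ε * κ ^ 2) *
      ∫⁻ x, ENNReal.ofReal (h x) ∂mixture ω Q (unif Θ) =
      ENNReal.ofReal (Real.exp ε) *
        ∫⁻ x, ENNReal.ofReal (κ ^ 2 * h x) ∂mixture ω Q (unif Θ) := by
    simp_rw [ENNReal.ofReal_mul hκ2]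
    rw [ENNReal.ofReal_mul (Real.exp_pos _).le,
      lintegral_const_mul _ (hc.measurable.ennreal_ofReal), mul_assoc]
  -- Strict superlevel sets on the left and weak ones on the right match the closed range `t / κ ^ 2
  -- ≤ h ≤ t` on the separating set.
  rw [hscale, lintegral_eq_lintegral_meas_lt _ (ae_of_all _ hnn) hc.aemeasurable,
    lintegral_eq_lintegral_meas_le _ (ae_of_all _ fun x => mul_nonneg hκ2 (hnn x))
      hc2.aemeasurable,
    ← lintegral_const_mul' _ _ ENNReal.ofReal_ne_top]
  refine setLIntegral_mono' measurableSet_Ioi fun t ht => ?_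
  rw [mixture_apply hω.le hω1, mixture_apply hω.le hω1, ← ENNReal.ofReal_mul (Real.exp_pos _).le]
  exact ENNReal.ofReal_le_ofReal (mixture_superlevel_le h0 hfin hmeas hconv hP hQ hε hω hω1 hδ
    hPQ hr hrd hD hc hκ hh ht)

theorem purify_le (hd : 1 ≤ d) (hq : 1 ≤ q) (hR : 0 < R) {c : Fin d → ℝ}
    (hΘ : Θ = lqBall q c (R / 2)) {ε : ℝ} (hε : 0 ≤ ε) (hδ : 0 ≤ δ) (hε' : 0 < ε') (hω : 0 < ω)
    (hω1 : ω ≤ 1) {P Q : Measure (Fin d → ℝ)} [IsProbabilityMeasure P] [IsProbabilityMeasure Q]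
    (hP : ∀ᵐ x ∂P, x ∈ Θ) (hQ : ∀ᵐ x ∂Q, x ∈ Θ)
    (hPQ : ∀ S, MeasurableSet S → P.real S ≤ Real.exp ε * Q.real S + δ)
    {S : Set (Fin d → ℝ)} (hS : MeasurableSet S) :
    purify q R ε' δ ω Θ P S ≤ ENNReal.ofReal (Real.exp (ε + ε')) * purify q R ε' δ ω Θ Q S := by
  have h0 : volume Θ ≠ 0 := hΘ ▸ volume_lqBall_ne_zero hq (by linarith)
  have hcomp : IsCompact Θ := hΘ ▸ isCompact_lqBall hq
  have hmeas : MeasurableSet Θ := hcomp.measurableSet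
  have hfin : volume Θ ≠ ∞ := hcomp.measure_lt_top.ne
  have hconv : Convex ℝ Θ := hΘ ▸ convex_lqBall hq
  have := isProbabilityMeasure_unif h0 hfin
  have hΔ : 0 ≤ noiseDelta d q R δ ω := noiseDelta_nonneg hR.le hδ hω.le
  have hb : 0 ≤ 2 * noiseDelta d q R δ ω / ε' := by positivity
  have := isProbabilityMeasure_laplaceVec (d := d) hb
  rw [purify_apply hω.le hω1 P hS, purify_apply hω.le hω1 Q hS]
  -- For `δ = 0` the noise scale is `0`, but the mixtures are already comparable without smoothing.
  rcases hδ.eq_or_lt with hδ0 | hδ0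
  · have hle : mixture ω P (unif Θ) ≤ ENNReal.ofReal (Real.exp (ε + ε')) •
        mixture ω Q (unif Θ) := by
      refine Measure.le_iff.2 fun A hA => ?_
      rw [Measure.smul_apply, smul_eq_mul, mixture_apply hω.le hω1, mixture_apply hω.le hω1,
        ← ENNReal.ofReal_mul (Real.exp_pos _).le]
      refine ENNReal.ofReal_le_ofReal ?_
      have h1 := hPQ A hA
      rw [← hδ0, add_zero] at h1
      have h2 : Real.exp ε ≤ Real.exp (ε + ε') := Real.exp_le_exp.2 (by linarith)
      have h3 : 1 ≤ Real.exp (ε + ε') := Real.one_le_exp (by linarith)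
      have hω' : 0 ≤ 1 - ω := by linarith
      calc (1 - ω) * P.real A + ω * (unif Θ).real A
          ≤ (1 - ω) * (Real.exp (ε + ε') * Q.real A) +
              Real.exp (ε + ε') * (ω * (unif Θ).real A) := by
            refine add_le_add (mul_le_mul_of_nonneg_left ?_ hω') ?_
            · exact h1.trans (by gcongr)
            · exact le_mul_of_one_le_left (by positivity) h3
        _ = _ := by ring
    exact (lintegral_mono' hle le_rfl).trans_eq (lintegral_smul_measure _ _)
  · set L := laplaceVec d (2 * noiseDelta d q R δ ω / ε')
    have hdpos : 0 < (d : ℝ) := by positivity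
    have hΔ0 : 0 < noiseDelta d q R δ ω := by
      unfold noiseDelta
      positivity
    have hb0 : 0 < 2 * noiseDelta d q R δ ω / ε' := by positivity
    have hexp : Real.exp (ε + ε') = Real.exp ε * Real.exp (ε' / 2) ^ 2 := by
      rw [← Real.exp_nat_mul, ← Real.exp_add]
      push_cast
      ring_nf
    -- The leading factor `2` in `Δ` covers the passage from `δ / (2 * ω)` to `δ / ω`, since `2 ^ (1
    -- / d) ≤ 2`.
    have hratio : (δ / ω) ^ (1 / (d : ℝ)) ≤ 2 * (δ / (2 * ω)) ^ (1 / (d : ℝ)) := by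
      have h2 : δ / ω = 2 * (δ / (2 * ω)) := by field_simp
      rw [h2, Real.mul_rpow zero_le_two (by positivity)]
      gcongr
      refine Real.rpow_le_self_of_one_le one_le_two ?_
      rw [div_le_one hdpos]
      exact_mod_cast hd
    have key := lintegral_mixture_le (κ := Real.exp (ε' / 2)) (r := (δ / ω) ^ (1 / (d : ℝ)))
      (D := (d : ℝ) ^ (1 - (q⁻¹).toReal) * R) (h := fun x => L.real ((x + ·) ⁻¹' S))
      h0 hfin hmeas hconv hP hQ hε hω hω1 hδ hPQ (by positivity)
      (by rw [one_div, Real.rpow_inv_natCast_pow (by positivity) (by positivity)])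
      (fun x hx y hy => by
        rw [hΘ] at hx hy
        refine (lqNorm_one_le hq _).trans ?_
        have := lqNorm_sub_le_of_mem_lqBall hq hx hy
        gcongr
        linarith)
      (continuous_laplaceVec_translate hb0 hS) (fun x => measureReal_nonneg)
      (Real.one_le_exp (by positivity))
      (fun x y hxy => by
        refine (laplaceVec_translate_le hb0 hS x y).trans ?_
        gcongr ?_ * _
        refine Real.exp_le_exp.2 ?_
        have hle : lqNorm 1 (x - y) ≤ noiseDelta d q R δ ω := by
          refine hxy.trans ?_
          calc _ ≤ 2 * (δ / (2 * ω)) ^ (1 / (d : ℝ)) * ((d : ℝ) ^ (1 - (q⁻¹).toReal) * R) := by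
                gcongr
            _ = _ := by unfold noiseDelta; ring
        rw [div_div_eq_mul_div, div_le_div_iff₀ (by positivity) two_pos]
        nlinarith)
    have hreal : ∀ x : Fin d → ℝ, ENNReal.ofReal (L.real ((x + ·) ⁻¹' S)) = L ((x + ·) ⁻¹' S) :=
      fun x => ofReal_measureReal
    simpa only [hreal, ← hexp] using key

end Privacy

/-! ### Moments of the noise and the expected displacement. -/

section Utility

/-- Log-convexity of `Γ` gives `log Γ(s) ≤ log Γ(n) + (s - n) * log n` for `n < s ≤ n + 1`. With
`Γ(n) = (n - 1)! ≤ n ^ (n - 1)`, the right side is at most `(s - 1) * log n`. -/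
theorem Gamma_add_one_le_rpow_self {s : ℝ} (hs : 1 ≤ s) : Real.Gamma (s + 1) ≤ s ^ s := by
  rcases hs.eq_or_lt with rfl | hs1
  · simp [one_add_one_eq_two]
  obtain ⟨n, hn⟩ : ∃ n : ℕ, ⌈s⌉₊ = n + 1 :=
    Nat.exists_eq_succ_of_ne_zero (Nat.ceil_pos.2 (by linarith)).ne'
  have hns : (n : ℝ) < s := Nat.lt_ceil.1 (by omega)
  have hsn : s ≤ n + 1 := by
    have := Nat.le_ceil s
    rw [hn] at this
    exact_mod_cast this
  have hn0 : n ≠ 0 := by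
    rintro rfl
    simp only [Nat.cast_zero, zero_add] at hsn
    linarith
  have hnpos : 0 < (n : ℝ) := by positivity
  have hs0 : 0 < s := by linarith
  have hlog := Real.BohrMollerup.f_add_nat_le (x := s - n) Real.convexOn_log_Gamma
    (fun {y} hy => by
      simp only [Function.comp_apply]
      rw [Real.Gamma_add_one hy.ne', Real.log_mul hy.ne' (Real.Gamma_pos_of_pos hy).ne', add_comm])
    hn0 (by linarith) (by linarith)
  simp only [Function.comp_apply, add_sub_cancel] at hlog
  have hfact : Real.Gamma n ≤ (n : ℝ) ^ ((n : ℝ) - 1) := by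
    obtain ⟨m, rfl⟩ := Nat.exists_eq_succ_of_ne_zero hn0
    rw [Nat.cast_succ, Real.Gamma_nat_eq_factorial, add_sub_cancel_right, Real.rpow_natCast]
    have := (Nat.factorial_le_pow m).trans (Nat.pow_le_pow_left (Nat.le_succ m) m)
    exact_mod_cast this
  have hgam : Real.log (Real.Gamma n) ≤ ((n : ℝ) - 1) * Real.log n := by
    rw [← Real.log_rpow hnpos]
    exact Real.log_le_log (Real.Gamma_pos_of_pos hnpos) hfact
  have hlogle : (s - 1) * Real.log n ≤ (s - 1) * Real.log s :=
    mul_le_mul_of_nonneg_left (Real.log_le_log hnpos hns.le) (by linarith)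
  have hfin : Real.log (Real.Gamma s) ≤ Real.log (s ^ (s - 1)) := by
    rw [Real.log_rpow hs0]
    linarith
  have hle := (Real.log_le_log_iff (Real.Gamma_pos_of_pos hs0) (by positivity)).1 hfin
  calc Real.Gamma (s + 1) = s * Real.Gamma s := Real.Gamma_add_one hs0.ne'
    _ ≤ s * s ^ (s - 1) := by gcongr
    _ = s ^ s := by
        rw [Real.rpow_sub_one hs0.ne']
        field_simp

variable {d : ℕ} {q : ℝ≥0∞} {R ε' δ ω : ℝ} {Θ : Set (Fin d → ℝ)}

/-- The `q`-th power of the norm is a sum over coordinates, so its mean is exact; Jensen for `x ↦ x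
^ q` passes back to the first moment. -/
theorem integral_lqNorm_laplaceVec_le {b : ℝ} (hb : 0 ≤ b) (hq : 1 ≤ q) (hq' : q ≠ ∞) :
    Integrable (lqNorm q) (laplaceVec d b) ∧
      ∫ z, lqNorm q z ∂laplaceVec d b ≤ (d : ℝ) ^ (1 / q.toReal) * (b * q.toReal) := by
  have := isProbabilityMeasure_laplace hb
  have := isProbabilityMeasure_laplaceVec (d := d) hb
  have hs := one_le_toReal hq hq'
  set s := q.toReal with hs_def
  have hs0 : 0 < s := by linarith
  obtain ⟨hi, he⟩ := integral_abs_rpow_laplace hb hs0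
  have hi' : ∀ i : Fin d, Integrable (fun z : Fin d → ℝ => |z i| ^ s) (laplaceVec d b) :=
    fun i => integrable_comp_eval (μ := fun _ : Fin d => laplace b) (i := i) hi
  have he' : ∀ i : Fin d, ∫ z : Fin d → ℝ, |z i| ^ s ∂laplaceVec d b =
      b ^ s * Real.Gamma (s + 1) := fun i =>
    (integral_comp_eval (μ := fun _ : Fin d => laplace b) (i := i)
      hi.aestronglyMeasurable).trans he
  have hpow : ∀ z : Fin d → ℝ, lqNorm q z ^ s = ∑ i, |z i| ^ s := by
    intro z
    rw [lqNorm_eq_sum hq hq', one_div, Real.rpow_inv_rpow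
      (Finset.sum_nonneg fun i _ => Real.rpow_nonneg (abs_nonneg _) _) hs0.ne']
  have hipow : Integrable (fun z => lqNorm q z ^ s) (laplaceVec d b) := by
    simp_rw [hpow]
    exact integrable_finsetSum _ fun i _ => hi' i
  have hepow : ∫ z, lqNorm q z ^ s ∂laplaceVec d b = d * (b ^ s * Real.Gamma (s + 1)) := by
    simp_rw [hpow]
    rw [integral_finsetSum _ fun i _ => hi' i]
    simp [he']
  -- Dominated by `1 + lqNorm q z ^ s`, as `s ≥ 1`.
  have hint : Integrable (lqNorm q) (laplaceVec d b) := by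
    refine ((integrable_const (1 : ℝ)).add hipow).mono'
      (continuous_lqNorm hq).aestronglyMeasurable (ae_of_all _ fun z => ?_)
    have h0 := lqNorm_nonneg hq z
    rw [Real.norm_of_nonneg h0, Pi.add_apply]
    rcases le_total (lqNorm q z) 1 with h1 | h1
    · have := Real.rpow_nonneg h0 s
      linarith
    · have := Real.self_le_rpow_of_one_le h1 hs
      linarith
  refine ⟨hint, ?_⟩
  have hjensen := (convexOn_rpow hs).map_integral_le
    (Real.continuous_rpow_const hs0.le).continuousOn isClosed_Ici
    (ae_of_all (laplaceVec d b) fun z => lqNorm_nonneg hq z) hint hipow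
  have hE : 0 ≤ ∫ z, lqNorm q z ∂laplaceVec d b := integral_nonneg fun z => lqNorm_nonneg hq z
  rw [hepow] at hjensen
  refine (Real.rpow_le_rpow_iff hE (by positivity) hs0).1 (hjensen.trans ?_)
  rw [Real.mul_rpow (by positivity) (by positivity), one_div,
    Real.rpow_inv_rpow (Nat.cast_nonneg d) hs0.ne', Real.mul_rpow hb hs0.le]
  gcongr
  exact Gamma_add_one_le_rpow_self hs

theorem unif_Icc_Iic (hω : 0 ≤ ω) (hω1 : ω ≤ 1) :
    (unif (Set.Icc (0 : ℝ) 1)).real (Set.Iic ω) = ω := by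
  have h := lintegral_unif_Icc_ite hω hω1 1 0
  have hfun : (fun t : ℝ => if t ≤ ω then (1 : ℝ≥0∞) else 0) = (Set.Iic ω).indicator 1 := by
    ext t
    simp [Set.indicator]
  rw [hfun, lintegral_indicator_one measurableSet_Iic, mul_zero, zero_add, mul_one] at h
  rw [measureReal_def, h, ENNReal.toReal_ofReal hω]

theorem integral_lqNorm_purifyJoint_le {p : ℝ≥0∞} (hp : 1 ≤ p) (hω : 0 ≤ ω) (hω1 : ω ≤ 1)
    (hmeas : MeasurableSet Θ) [IsProbabilityMeasure (unif Θ)]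
    [IsProbabilityMeasure (laplaceVec d (2 * noiseDelta d q R δ ω / ε'))]
    {μ : Measure (Fin d → ℝ)} [IsProbabilityMeasure μ] (hμ : ∀ᵐ x ∂μ, x ∈ Θ) {C : ℝ}
    (hC : ∀ x ∈ Θ, ∀ y ∈ Θ, lqNorm p (x - y) ≤ C)
    (hL : Integrable (lqNorm p) (laplaceVec d (2 * noiseDelta d q R δ ω / ε'))) :
    Integrable (fun s => lqNorm p (s.2 - s.1)) (purifyJoint q R ε' δ ω Θ μ) ∧
      ∫ s, lqNorm p (s.2 - s.1) ∂purifyJoint q R ε' δ ω Θ μ ≤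
        ω * C + ∫ z, lqNorm p z ∂laplaceVec d (2 * noiseDelta d q R δ ω / ε') := by
  have := isProbabilityMeasure_unif_Icc
  set L := laplaceVec d (2 * noiseDelta d q R δ ω / ε')
  set I := unif (Set.Icc (0 : ℝ) 1)
  set π := μ.prod (I.prod ((unif Θ).prod L)) with hπ
  have hmap : Measurable fun s : (Fin d → ℝ) × ℝ × (Fin d → ℝ) × (Fin d → ℝ) =>
      (s.1, purifyPoint ω s.1 s.2.1 s.2.2.1 s.2.2.2) :=
    measurable_fst.prodMk measurable_purifyPoint
  have hcont : Continuous fun s : (Fin d → ℝ) × (Fin d → ℝ) => lqNorm p (s.2 - s.1) :=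
    (continuous_lqNorm hp).comp (continuous_snd.sub continuous_fst)
  have mpx : MeasurePreserving Prod.fst π μ := measurePreserving_fst
  have mpt : MeasurePreserving (fun s => s.2.1) π I :=
    measurePreserving_fst.comp measurePreserving_snd
  have mpy : MeasurePreserving (fun s => s.2.2.1) π (unif Θ) :=
    measurePreserving_fst.comp (measurePreserving_snd.comp measurePreserving_snd)
  have mpz : MeasurePreserving (fun s => s.2.2.2) π L :=
    measurePreserving_snd.comp (measurePreserving_snd.comp measurePreserving_snd)
  have hx : ∀ᵐ s ∂π, s.1 ∈ Θ := mpx.quasiMeasurePreserving.ae hμ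
  have hy : ∀ᵐ s ∂π, s.2.2.1 ∈ Θ := mpy.quasiMeasurePreserving.ae (ae_cond_mem hmeas)
  have hindI : Integrable ((Set.Iic ω).indicator fun _ => C) I :=
    (integrable_const C).indicator measurableSet_Iic
  have hindE : ∫ t, (Set.Iic ω).indicator (fun _ => C) t ∂I = ω * C := by
    rw [integral_indicator_const _ measurableSet_Iic, unif_Icc_Iic hω hω1, smul_eq_mul]
  have ht_int : Integrable (fun s => (Set.Iic ω).indicator (fun _ => C) s.2.1) π :=
    mpt.integrable_comp_of_integrable hindI
  have hz_int : Integrable (fun s => lqNorm p s.2.2.2) π := mpz.integrable_comp_of_integrable hL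
  have ht_eq : ∫ s, (Set.Iic ω).indicator (fun _ => C) s.2.1 ∂π = ω * C := by
    rw [← hindE, ← mpt.map_eq]
    exact (integral_map mpt.measurable.aemeasurable
      (mpt.map_eq.symm ▸ hindI.aestronglyMeasurable)).symm
  have hz_eq : ∫ s, lqNorm p s.2.2.2 ∂π = ∫ z, lqNorm p z ∂L := by
    rw [← mpz.map_eq]
    exact (integral_map mpz.measurable.aemeasurable
      (mpz.map_eq.symm ▸ hL.aestronglyMeasurable)).symm
  -- The displacement is `z` when the point is kept, and `(y - x) + z` when it is replaced.
  have hbound : ∀ᵐ s ∂π, lqNorm p (purifyPoint ω s.1 s.2.1 s.2.2.1 s.2.2.2 - s.1) ≤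
      (Set.Iic ω).indicator (fun _ => C) s.2.1 + lqNorm p s.2.2.2 := by
    filter_upwards [hx, hy] with s hsx hsy
    unfold purifyPoint
    by_cases ht : s.2.1 ≤ ω
    · rw [if_pos ht, Set.indicator_of_mem (Set.mem_Iic.2 ht), add_sub_right_comm]
      exact (lqNorm_add_le hp _ _).trans (add_le_add_left (hC _ hsy _ hsx) _)
    · rw [if_neg ht, Set.indicator_of_notMem (by simpa using ht), add_sub_cancel_left, zero_add]
  have hint : Integrable
      (fun s => lqNorm p (purifyPoint ω s.1 s.2.1 s.2.2.1 s.2.2.2 - s.1)) π := by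
    refine (ht_int.add hz_int).mono' (hcont.measurable.comp hmap).aestronglyMeasurable ?_
    filter_upwards [hbound] with s hs
    rwa [Real.norm_of_nonneg (lqNorm_nonneg hp _)]
  refine ⟨?_, ?_⟩
  · rw [purifyJoint, integrable_map_measure hcont.aestronglyMeasurable hmap.aemeasurable]
    exact hint
  · rw [purifyJoint, integral_map hmap.aemeasurable hcont.aestronglyMeasurable, ← ht_eq, ← hz_eq,
      ← integral_add ht_int hz_int]
    exact integral_mono_ae hint (ht_int.add hz_int) hbound

end Utility

end Purify

/-! ### Assembly of the privacy and utility bounds. -/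

theorem theorem1 {𝒟 : Type*} (nbr : 𝒟 → 𝒟 → Prop) (hnbr : ∀ D D', nbr D D' → nbr D' D)
    (d : ℕ) (hd : 1 ≤ d) (q : ℝ≥0∞) (hq : 1 ≤ q)
    (c : Fin d → ℝ) (R : ℝ) (hR : 0 < R)
    (Θ : Set (Fin d → ℝ)) (hΘ : Θ = Purify.lqBall q c (R / 2))
    (ε δ ε' ω : ℝ) (hε : 0 ≤ ε) (hδ : 0 ≤ δ) (hε' : 0 < ε') (hω : 0 < ω) (hω1 : ω ≤ 1)
    (M : 𝒟 → Measure (Fin d → ℝ)) (hM : ∀ D, IsProbabilityMeasure (M D))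
    (hrange : ∀ D, ∀ᵐ x ∂(M D), x ∈ Θ)
    (hDP : Purify.IsDP nbr M ε δ) :
    Purify.IsDP nbr (fun D => Purify.purify q R ε' δ ω Θ (M D)) (ε + ε') 0 ∧
    ∀ D,
      -- the utility guarantee in the `ℓ_1` norm, for a ball in the `ℓ_1` norm
      (q = 1 →
        Integrable (fun p => Purify.lqNorm 1 (p.2 - p.1))
          (Purify.purifyJoint q R ε' δ ω Θ (M D)) ∧
        ∫ p, Purify.lqNorm 1 (p.2 - p.1) ∂(Purify.purifyJoint q R ε' δ ω Θ (M D)) ≤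
          ω * R + 4 * R * d / ε' * (δ / (2 * ω)) ^ (1 / (d : ℝ))) ∧
      -- the utility guarantee in the `ℓ_q` norm, for a ball in the `ℓ_q` norm
      (q ≠ ∞ →
        Integrable (fun p => Purify.lqNorm q (p.2 - p.1))
          (Purify.purifyJoint q R ε' δ ω Θ (M D)) ∧
        ∫ p, Purify.lqNorm q (p.2 - p.1) ∂(Purify.purifyJoint q R ε' δ ω Θ (M D)) ≤
          ω * R + 4 * R * d * q.toReal / ε' * (δ / (2 * ω)) ^ (1 / (d : ℝ))) ∧
      -- the utility guarantee in the `ℓ_1` norm, for a ball in the `ℓ_q` norm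
      (Integrable (fun p => Purify.lqNorm 1 (p.2 - p.1))
          (Purify.purifyJoint q R ε' δ ω Θ (M D)) ∧
        ∫ p, Purify.lqNorm 1 (p.2 - p.1) ∂(Purify.purifyJoint q R ε' δ ω Θ (M D)) ≤
          (d : ℝ) ^ (1 - (q⁻¹).toReal) *
            (ω * R + 4 * R * d / ε' * (δ / (2 * ω)) ^ (1 / (d : ℝ)))) := by
  have h0 : volume Θ ≠ 0 := hΘ ▸ Purify.volume_lqBall_ne_zero hq (by linarith)
  have hcomp : IsCompact Θ := hΘ ▸ Purify.isCompact_lqBall hq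
  have hΔ : 0 ≤ Purify.noiseDelta d q R δ ω := Purify.noiseDelta_nonneg hR.le hδ hω.le
  have hb : 0 ≤ 2 * Purify.noiseDelta d q R δ ω / ε' := by positivity
  have := Purify.isProbabilityMeasure_unif h0 hcomp.measure_lt_top.ne
  have := Purify.isProbabilityMeasure_laplaceVec (d := d) hb
  have hdpos : 0 < (d : ℝ) := by positivity
  have hdiam : ∀ x ∈ Θ, ∀ y ∈ Θ, Purify.lqNorm q (x - y) ≤ R := by
    intro x hx y hy
    rw [hΘ] at hx hy
    linarith [Purify.lqNorm_sub_le_of_mem_lqBall hq hx hy]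
  refine ⟨?_, fun D => ?_⟩
  · intro D D' hDD' S hS
    have := Purify.isProbabilityMeasure_purify (q := q) (R := R) (ε' := ε') (δ := δ) (ω := ω)
      (Θ := Θ) (M D')
    have h := ENNReal.toReal_mono (ENNReal.mul_ne_top ENNReal.ofReal_ne_top (measure_ne_top _ _))
      (Purify.purify_le hd hq hR hΘ hε hδ hε' hω hω1 (hrange D) (hrange D') (hDP D D' hDD') hS)
    rw [ENNReal.toReal_mul, ENNReal.toReal_ofReal (Real.exp_pos _).le] at h
    rw [add_zero]
    exact h
  · have hone : Integrable (fun p => Purify.lqNorm 1 (p.2 - p.1))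
          (Purify.purifyJoint q R ε' δ ω Θ (M D)) ∧
        ∫ p, Purify.lqNorm 1 (p.2 - p.1) ∂(Purify.purifyJoint q R ε' δ ω Θ (M D)) ≤
          (d : ℝ) ^ (1 - (q⁻¹).toReal) *
            (ω * R + 4 * R * d / ε' * (δ / (2 * ω)) ^ (1 / (d : ℝ))) := by
      obtain ⟨hi, he⟩ := Purify.integral_lqNorm_one_laplaceVec (d := d) hb
      obtain ⟨hI, hE⟩ := Purify.integral_lqNorm_purifyJoint_le (q := q) (R := R) (ε' := ε')
        (δ := δ) le_rfl hω.le hω1 hcomp.measurableSet (hrange D)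
        -- This bounds the `ℓ_1` diameter of `Θ`.
        (C := (d : ℝ) ^ (1 - (q⁻¹).toReal) * R)
        (fun x hx y hy => (Purify.lqNorm_one_le hq _).trans (by gcongr; exact hdiam x hx y hy)) hi
      refine ⟨hI, hE.trans_eq ?_⟩
      rw [he, Purify.noiseDelta]
      ring
    refine ⟨?_, fun hq' => ?_, hone⟩
    · rintro rfl
      simpa using hone
    · obtain ⟨hi, he⟩ := Purify.integral_lqNorm_laplaceVec_le (d := d) hb hq hq'
      obtain ⟨hI, hE⟩ := Purify.integral_lqNorm_purifyJoint_le (q := q) (R := R) (ε' := ε')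
        (δ := δ) hq hω.le hω1 hcomp.measurableSet (hrange D) hdiam hi
      refine ⟨hI, hE.trans (add_le_add_right (he.trans_eq ?_) _)⟩
      -- The dimension factor of the noise moment and that of `Δ` have exponents summing to `1`,
      -- whence the single factor `d`.
      have hsplit : (d : ℝ) ^ (1 / q.toReal) * (d : ℝ) ^ (1 - (q⁻¹).toReal) = d := by
        rw [← Real.rpow_add hdpos, ENNReal.toReal_inv, one_div, add_sub_cancel, Real.rpow_one]
      calc _ = (d : ℝ) ^ (1 / q.toReal) * (d : ℝ) ^ (1 - (q⁻¹).toReal) *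
            (4 * R * q.toReal / ε' * (δ / (2 * ω)) ^ (1 / (d : ℝ))) := by
            rw [Purify.noiseDelta]
            ring
        _ = _ := by
            rw [hsplit]
            ring
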